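/- For $0<\varepsilon<1$ let $E(\varepsilon)=\{(x,y)\in\mathbb{R}^2:\ \varepsilon^2x^2+\frac{\varepsilon^2}{1-\varepsilon^2}y^2=1\}$ be the ellipse of eccentricity $\varepsilon$ with foci $(\pm1,0)$. Let $0<f<e<1$, so that $E(e)$ lies inside $E(f)$. Then for each $z\in E(f)$ there is a unique point $w\in E(f)$ such that the directed segment from $z$ to $w$ is tangent to $E(e)$ with $E(e)$ on its left. The resulting map $B_e^f:E(f)\to E(f)$, $z\mapsto w$ (the Poncelet map, that is, the billiard map of $E(f)$ restricted to the positively oriented orbits with caustic $E(e)$), is a homeomorphism. It has a lift, by which we mean a continuous nondecreasing $G:\mathbb{R}\to\mathbb{R}$ with $G(t+1)=G(t)+1$ and $\gamma\circ G=B_e^f\circ\gamma$, where $\gamma(t)=\frac1f\bigl(\cos 2\pi t,\sqrt{1-f^2}\,\sin 2\pi t\bigr)$ is the counterclockwise parametrization of $E(f)$ by $\mathbb{R}/\mathbb{Z}$. The rotation number of $B_e^f$, that is, the number $\hat\rho(e,f)\in[0,1)$ that is congruent modulo $1$ to $\lim_{n\to\infty}\frac{G^n(t)-t}{n}$ for every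 lift $G$ (the limit exists and does not depend on $t$), is $$\hat\rho(e,f)=\frac{F(\hat\omega(e,f),e)}{2K(e)},\qquad \hat\omega(e,f)=\arcsin\sqrt{\frac{e^2-f^2}{e^2(1-f^2)}},$$ where $F(\phi,e)=\int_0^\phi\frac{d\tau}{\sqrt{1-e^2\sin^2\tau}}$ is the incomplete elliptic integral of the first kind with modulus $e$, and $K(e)=F(\tfrac{\pi}{2},e)$. -/

import Mathlib

/-- The ellipse of eccentricity `ε ∈ (0, 1)` with foci `(±1, 0)`. -/
def confocalEllipse (ε : ℝ) : Set (ℝ × ℝ) :=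
  {p | ε ^ 2 * p.1 ^ 2 + ε ^ 2 / (1 - ε ^ 2) * p.2 ^ 2 = 1}

/-- The cross product of two plane vectors; it is nonnegative exactly when `v` does not point
to the right of `u`. -/
def planeCross (u v : ℝ × ℝ) : ℝ := u.1 * v.2 - u.2 * v.1

/-- The directed segment from `z` to `w` is tangent to the convex curve `C`, with `C` on the left:
the segment is nondegenerate, it touches `C`, and the line that it spans is a supporting line of `C`
whose closed left half-plane contains `C`. -/
def IsPositivelyTangent (C : Set (ℝ × ℝ)) (z w : ℝ × ℝ) : Prop :=
  z ≠ w ∧ (∃ p ∈ C, p ∈ segment ℝ z w) ∧ ∀ q ∈ C, 0 ≤ planeCross (w - z) (q - z)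

/-- `P` is the Poncelet map of the outer curve `Co` and the inner curve `Ci`: for each `z` on `Co`,
`P z` is the unique point `w` of `Co` such that the segment from `z` to `w` is tangent to `Ci` with
`Ci` on the left. -/
def IsPonceletMap (Co Ci : Set (ℝ × ℝ)) (P : Co → Co) : Prop :=
  ∀ z w : Co, IsPositivelyTangent Ci z w ↔ w = P z

/-- The counterclockwise parametrization `t ↦ (1/f) (cos 2πt, √(1 - f²) sin 2πt)` of
`confocalEllipse f`. It identifies the ellipse with the circle `ℝ / ℤ`. -/
noncomputable def ellipseParam (f : ℝ) (hf0 : 0 < f) (hf1 : f < 1) (t : ℝ) : confocalEllipse f :=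
  ⟨(1 / f * Real.cos (2 * Real.pi * t),
    1 / f * (Real.sqrt (1 - f ^ 2) * Real.sin (2 * Real.pi * t))), by
    have h : 0 < 1 - f ^ 2 := by nlinarith
    have hs : Real.sqrt (1 - f ^ 2) ^ 2 = 1 - f ^ 2 := Real.sq_sqrt h.le
    have hc := Real.cos_sq_add_sin_sq (2 * Real.pi * t)
    have hf : f ≠ 0 := hf0.ne'
    have h' : 1 - f ^ 2 ≠ 0 := h.ne'
    simp only [confocalEllipse, Set.mem_ofPred_eq, mul_pow, hs]
    field_simp
    exact hc⟩

/-- `G` is a lift of the self-map `P` of the topological circle `X`, with respect to the oriented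
parametrization `γ : ℝ → X` (of period 1): a continuous monotone map `G : ℝ → ℝ` with
`G (t + 1) = G t + 1` and `γ ∘ G = P ∘ γ`. -/
def IsCircleLift {X : Type*} (γ : ℝ → X) (P : X → X) (G : CircleDeg1Lift) : Prop :=
  Continuous G ∧ ∀ t : ℝ, γ (G t) = P (γ t)

/-- `ρ` is the Poincaré rotation number of `P`, normalized to lie in `[0, 1)`: the map `P` has a lift,
and each lift `G` has translation number `lim (G^n x - x) / n` congruent to `ρ` modulo `1`. -/
def HasRotationNumber {X : Type*} (γ : ℝ → X) (P : X → X) (ρ : ℝ) : Prop :=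
  ρ ∈ Set.Ico (0 : ℝ) 1 ∧ (∃ G : CircleDeg1Lift, IsCircleLift γ P G) ∧
    ∀ G : CircleDeg1Lift, IsCircleLift γ P G → ∃ m : ℤ, G.translationNumber = ρ + m

/-- The incomplete elliptic integral of the first kind `F(φ, e)`, with modulus `e`. -/
noncomputable def ellipticF (φ e : ℝ) : ℝ :=
  ∫ τ in (0 : ℝ)..φ, 1 / Real.sqrt (1 - e ^ 2 * Real.sin τ ^ 2)

/-- The complete elliptic integral of the first kind `K(e)`. -/
noncomputable def ellipticK (e : ℝ) : ℝ := ellipticF (Real.pi / 2) e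

/-- The angle `arcsin √((e² - f²) / (e² (1 - f²)))`. -/
noncomputable def billiardAngle (e f : ℝ) : ℝ :=
  Real.arcsin (Real.sqrt ((e ^ 2 - f ^ 2) / (e ^ 2 * (1 - f ^ 2))))

/-! ### The elliptic integral of the first kind -/

section EllipticIntegral

/-! Jacobi's elliptic functions of modulus `e`, the eccentricity of the caustic, straighten the
Poncelet map. Both ellipses are parametrized by u ↦ (1/ε)(-sn u, √(1-ε²) cn u), with ε = e or f but
the same modulus e. With c = F(ω̂, e), the chord of E(f) from parameter s - c to s + c touches E(e)
at its point of parameter s (`isPositivelyTangent_jacobiParam`). This is a computation with the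
addition theorems for sn and cn and the values of sn, cn, dn at c.

A positively tangent chord is determined by its initial point
(`IsPositivelyTangent.endpoint_unique`), so the Poncelet map is u ↦ u + 2c. The parametrization has
period 4K(e), so the map is conjugate to the rotation of ℝ/4Kℤ by 2c, and its rotation number is
2c/4K = F(ω̂, e)/2K. -/

theorem one_sub_sq_mul_sin_sq_pos {e : ℝ} (he0 : 0 < e) (he1 : e < 1) (τ : ℝ) :
    0 < 1 - e ^ 2 * Real.sin τ ^ 2 := by
  have h1 := Real.sin_sq_le_one τ
  have h2 : e ^ 2 < 1 := by nlinarith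
  nlinarith [sq_nonneg e]

theorem continuous_ellipticF_integrand {e : ℝ} (he0 : 0 < e) (he1 : e < 1) :
    Continuous fun τ : ℝ => 1 / Real.sqrt (1 - e ^ 2 * Real.sin τ ^ 2) :=
  Continuous.div continuous_const (by fun_prop) fun τ =>
    (Real.sqrt_pos.2 (one_sub_sq_mul_sin_sq_pos he0 he1 τ)).ne'

theorem hasDerivAt_ellipticF {e : ℝ} (he0 : 0 < e) (he1 : e < 1) (φ : ℝ) :
    HasDerivAt (fun φ => ellipticF φ e) (1 / Real.sqrt (1 - e ^ 2 * Real.sin φ ^ 2)) φ :=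
  intervalIntegral.integral_hasDerivAt_right
    ((continuous_ellipticF_integrand he0 he1).intervalIntegrable _ _)
    (continuous_ellipticF_integrand he0 he1).aestronglyMeasurable.stronglyMeasurableAtFilter
    (continuous_ellipticF_integrand he0 he1).continuousAt

theorem continuous_ellipticF {e : ℝ} (he0 : 0 < e) (he1 : e < 1) :
    Continuous fun φ => ellipticF φ e :=
  continuous_iff_continuousAt.2 fun φ => (hasDerivAt_ellipticF he0 he1 φ).continuousAt

theorem strictMono_ellipticF {e : ℝ} (he0 : 0 < e) (he1 : e < 1) :
    StrictMono fun φ => ellipticF φ e :=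
  strictMono_of_deriv_pos fun φ => by
    rw [(hasDerivAt_ellipticF he0 he1 φ).deriv]
    exact one_div_pos.2 (Real.sqrt_pos.2 (one_sub_sq_mul_sin_sq_pos he0 he1 φ))

theorem ellipticF_zero (e : ℝ) : ellipticF 0 e = 0 := by simp [ellipticF]

theorem ellipticF_neg (φ e : ℝ) : ellipticF (-φ) e = -ellipticF φ e := by
  have h := intervalIntegral.integral_comp_neg (a := 0) (b := φ)
    (fun τ : ℝ => 1 / Real.sqrt (1 - e ^ 2 * Real.sin τ ^ 2))
  simp only [Real.sin_neg, neg_sq, neg_zero] at h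
  rw [ellipticF, ellipticF, h, ← intervalIntegral.integral_symm]

/-- The integrand has period π, so its integral over a period may be taken on [-π/2, π/2], where
evenness gives 2K. -/
theorem ellipticF_add_pi {e : ℝ} (he0 : 0 < e) (he1 : e < 1) (φ : ℝ) :
    ellipticF (φ + Real.pi) e = ellipticF φ e + 2 * ellipticK e := by
  have hi := fun a b =>
    (continuous_ellipticF_integrand he0 he1).intervalIntegrable (μ := MeasureTheory.volume) a b
  have hp : Function.Periodic
      (fun τ : ℝ => 1 / Real.sqrt (1 - e ^ 2 * Real.sin τ ^ 2)) Real.pi := fun τ => by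
    simp [Real.sin_add_pi]
  have h1 := hp.intervalIntegral_add_eq φ (-(Real.pi / 2))
  have h2 := intervalIntegral.integral_add_adjacent_intervals (hi 0 φ) (hi φ (φ + Real.pi))
  have h3 := intervalIntegral.integral_add_adjacent_intervals (hi 0 (-(Real.pi / 2)))
    (hi (-(Real.pi / 2)) (-(Real.pi / 2) + Real.pi))
  have h4 := ellipticF_neg (Real.pi / 2) e
  rw [show -(Real.pi / 2) + Real.pi = Real.pi / 2 by ring] at h1 h3
  simp only [ellipticK, ellipticF] at *
  linarith

theorem ellipticF_add_two_pi {e : ℝ} (he0 : 0 < e) (he1 : e < 1) (φ : ℝ) :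
    ellipticF (φ + 2 * Real.pi) e = ellipticF φ e + 4 * ellipticK e := by
  rw [show φ + 2 * Real.pi = φ + Real.pi + Real.pi by ring, ellipticF_add_pi he0 he1,
    ellipticF_add_pi he0 he1]
  ring

theorem ellipticK_pos {e : ℝ} (he0 : 0 < e) (he1 : e < 1) : 0 < ellipticK e := by
  rw [ellipticK, ← ellipticF_zero e]
  exact strictMono_ellipticF he0 he1 Real.pi_div_two_pos

/-- The integrand is at least 1. This makes F unbounded, hence surjective, so that the amplitude is
defined on all of ℝ. -/
theorem le_ellipticF {e : ℝ} (he0 : 0 < e) (he1 : e < 1) {φ : ℝ} (hφ : 0 ≤ φ) :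
    φ ≤ ellipticF φ e := by
  have h : ∫ _ in (0 : ℝ)..φ, (1 : ℝ) ≤ ellipticF φ e := by
    refine intervalIntegral.integral_mono hφ (by simp)
      ((continuous_ellipticF_integrand he0 he1).intervalIntegrable _ _) fun τ => ?_
    have h0 := one_sub_sq_mul_sin_sq_pos he0 he1 τ
    refine (one_le_div (Real.sqrt_pos.2 h0)).2 (Real.sqrt_le_one.2 ?_)
    nlinarith [mul_nonneg (sq_nonneg e) (sq_nonneg (Real.sin τ))]
  simpa using h

theorem surjective_ellipticF {e : ℝ} (he0 : 0 < e) (he1 : e < 1) :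
    Function.Surjective fun φ => ellipticF φ e := by
  refine (continuous_ellipticF he0 he1).surjective ?_ ?_
  · exact Filter.tendsto_atTop_mono' _ ((Filter.eventually_ge_atTop 0).mono fun φ hφ =>
      le_ellipticF he0 he1 hφ) Filter.tendsto_id
  · refine Filter.tendsto_atBot_mono' _ ((Filter.eventually_le_atBot 0).mono fun φ hφ => ?_)
      Filter.tendsto_id
    have h := le_ellipticF he0 he1 (neg_nonneg.2 hφ)
    rw [ellipticF_neg] at h
    exact le_of_neg_le_neg h

end EllipticIntegral

/-! ### Jacobi's elliptic functions -/

section Jacobi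

/-- Jacobi's amplitude, the inverse of the incomplete elliptic integral of the first kind. -/
noncomputable def jacobiAm (e u : ℝ) : ℝ := Function.invFun (fun φ => ellipticF φ e) u

/-- Jacobi's elliptic sine with modulus `e`. -/
noncomputable def jacobiSn (e u : ℝ) : ℝ := Real.sin (jacobiAm e u)

/-- Jacobi's elliptic cosine with modulus `e`. -/
noncomputable def jacobiCn (e u : ℝ) : ℝ := Real.cos (jacobiAm e u)

/-- Jacobi's delta amplitude with modulus `e`. -/
noncomputable def jacobiDn (e u : ℝ) : ℝ := Real.sqrt (1 - e ^ 2 * jacobiSn e u ^ 2)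

theorem ellipticF_jacobiAm {e : ℝ} (he0 : 0 < e) (he1 : e < 1) (u : ℝ) :
    ellipticF (jacobiAm e u) e = u :=
  Function.rightInverse_invFun (surjective_ellipticF he0 he1) u

theorem jacobiAm_ellipticF {e : ℝ} (he0 : 0 < e) (he1 : e < 1) (φ : ℝ) :
    jacobiAm e (ellipticF φ e) = φ :=
  Function.leftInverse_invFun (strictMono_ellipticF he0 he1).injective φ

theorem strictMono_jacobiAm {e : ℝ} (he0 : 0 < e) (he1 : e < 1) : StrictMono (jacobiAm e) :=
  fun u v h => (strictMono_ellipticF he0 he1).lt_iff_lt.1 <| by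
    simpa only [ellipticF_jacobiAm he0 he1] using h

theorem continuous_jacobiAm {e : ℝ} (he0 : 0 < e) (he1 : e < 1) : Continuous (jacobiAm e) :=
  (strictMono_jacobiAm he0 he1).monotone.continuous_of_surjective fun φ =>
    ⟨ellipticF φ e, jacobiAm_ellipticF he0 he1 φ⟩

theorem jacobiDn_pos {e : ℝ} (he0 : 0 < e) (he1 : e < 1) (u : ℝ) : 0 < jacobiDn e u :=
  Real.sqrt_pos.2 (one_sub_sq_mul_sin_sq_pos he0 he1 _)

theorem jacobiDn_sq {e : ℝ} (he0 : 0 < e) (he1 : e < 1) (u : ℝ) :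
    jacobiDn e u ^ 2 = 1 - e ^ 2 * jacobiSn e u ^ 2 :=
  Real.sq_sqrt (one_sub_sq_mul_sin_sq_pos he0 he1 _).le

theorem jacobiCn_sq (e u : ℝ) : jacobiCn e u ^ 2 = 1 - jacobiSn e u ^ 2 := Real.cos_sq' _

theorem hasDerivAt_jacobiAm {e : ℝ} (he0 : 0 < e) (he1 : e < 1) (u : ℝ) :
    HasDerivAt (jacobiAm e) (jacobiDn e u) u := by
  have h := (hasDerivAt_ellipticF he0 he1 (jacobiAm e u)).of_local_left_inverse
    (continuous_jacobiAm he0 he1).continuousAt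
    (one_div_pos.2 (jacobiDn_pos he0 he1 u)).ne'
    (Filter.Eventually.of_forall (ellipticF_jacobiAm he0 he1))
  rwa [one_div, inv_inv] at h

theorem hasDerivAt_jacobiSn {e : ℝ} (he0 : 0 < e) (he1 : e < 1) (u : ℝ) :
    HasDerivAt (jacobiSn e) (jacobiCn e u * jacobiDn e u) u :=
  (hasDerivAt_jacobiAm he0 he1 u).sin

theorem hasDerivAt_jacobiCn {e : ℝ} (he0 : 0 < e) (he1 : e < 1) (u : ℝ) :
    HasDerivAt (jacobiCn e) (-jacobiSn e u * jacobiDn e u) u :=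
  (hasDerivAt_jacobiAm he0 he1 u).cos

theorem hasDerivAt_jacobiDn {e : ℝ} (he0 : 0 < e) (he1 : e < 1) (u : ℝ) :
    HasDerivAt (jacobiDn e) (-e ^ 2 * jacobiSn e u * jacobiCn e u) u := by
  have hd := (jacobiDn_pos he0 he1 u).ne'
  have h := ((((hasDerivAt_jacobiSn he0 he1 u).pow 2).const_mul (e ^ 2)).const_sub 1).sqrt
    (one_sub_sq_mul_sin_sq_pos he0 he1 _).ne'
  refine h.congr_deriv ?_
  change _ / (2 * jacobiDn e u) = _
  field_simp
  norm_num
  ring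

theorem jacobiAm_zero {e : ℝ} (he0 : 0 < e) (he1 : e < 1) : jacobiAm e 0 = 0 := by
  simpa only [ellipticF_zero] using jacobiAm_ellipticF he0 he1 0

theorem jacobiAm_neg {e : ℝ} (he0 : 0 < e) (he1 : e < 1) (u : ℝ) :
    jacobiAm e (-u) = -jacobiAm e u := by
  conv_lhs => rw [← ellipticF_jacobiAm he0 he1 u, ← ellipticF_neg]
  exact jacobiAm_ellipticF he0 he1 _

theorem jacobiSn_neg {e : ℝ} (he0 : 0 < e) (he1 : e < 1) (u : ℝ) :
    jacobiSn e (-u) = -jacobiSn e u := by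
  rw [jacobiSn, jacobiAm_neg he0 he1, Real.sin_neg, jacobiSn]

theorem jacobiCn_neg {e : ℝ} (he0 : 0 < e) (he1 : e < 1) (u : ℝ) :
    jacobiCn e (-u) = jacobiCn e u := by
  rw [jacobiCn, jacobiAm_neg he0 he1, Real.cos_neg, jacobiCn]

theorem jacobiDn_neg {e : ℝ} (he0 : 0 < e) (he1 : e < 1) (u : ℝ) :
    jacobiDn e (-u) = jacobiDn e u := by
  rw [jacobiDn, jacobiSn_neg he0 he1, neg_sq, jacobiDn]

theorem jacobi_addition_denom_pos {e : ℝ} (he0 : 0 < e) (he1 : e < 1) (u v : ℝ) :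
    0 < 1 - e ^ 2 * jacobiSn e u ^ 2 * jacobiSn e v ^ 2 := by
  have h1 : jacobiSn e u ^ 2 ≤ 1 := Real.sin_sq_le_one _
  have h2 : jacobiSn e v ^ 2 ≤ 1 := Real.sin_sq_le_one _
  have h3 : e ^ 2 < 1 := by nlinarith
  have h4 := mul_le_one₀ h1 (sq_nonneg _) h2
  nlinarith [mul_nonneg (sq_nonneg (jacobiSn e u)) (sq_nonneg (jacobiSn e v)), sq_nonneg e]

/-- The addition theorem for the elliptic sine. -/
theorem jacobiSn_add {e : ℝ} (he0 : 0 < e) (he1 : e < 1) (u v : ℝ) :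
    jacobiSn e (u + v) =
      (jacobiSn e u * jacobiCn e v * jacobiDn e v + jacobiSn e v * jacobiCn e u * jacobiDn e u) /
        (1 - e ^ 2 * jacobiSn e u ^ 2 * jacobiSn e v ^ 2) := by
  set w := u + v with hw
  -- The right-hand side of the addition formula along the line of pairs (t, w - t) with fixed sum.
  -- It is constant; t = u gives the formula and t = 0 gives sn w.
  let g : ℝ → ℝ := fun t =>
    (jacobiSn e t * jacobiCn e (w - t) * jacobiDn e (w - t)
        + jacobiSn e (w - t) * jacobiCn e t * jacobiDn e t) /
      (1 - e ^ 2 * jacobiSn e t ^ 2 * jacobiSn e (w - t) ^ 2)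
  have hg : ∀ t, HasDerivAt g 0 t := fun t => by
    have hs := hasDerivAt_jacobiSn he0 he1 t
    have hc := hasDerivAt_jacobiCn he0 he1 t
    have hd := hasDerivAt_jacobiDn he0 he1 t
    have hs' := (hasDerivAt_jacobiSn he0 he1 (w - t)).comp_const_sub w t
    have hc' := (hasDerivAt_jacobiCn he0 he1 (w - t)).comp_const_sub w t
    have hd' := (hasDerivAt_jacobiDn he0 he1 (w - t)).comp_const_sub w t
    have hD := (jacobi_addition_denom_pos he0 he1 t (w - t)).ne'
    have h := (((hs.mul hc').mul hd').add ((hs'.mul hc).mul hd)).div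
      ((((hs.pow 2).const_mul (e ^ 2)).mul (hs'.pow 2)).const_sub 1) hD
    refine h.congr_deriv (div_eq_zero_iff.2 (Or.inl ?_))
    have hcs := jacobiCn_sq e t
    have hcs' := jacobiCn_sq e (w - t)
    have hds := jacobiDn_sq he0 he1 t
    have hds' := jacobiDn_sq he0 he1 (w - t)
    simp only [Pi.mul_apply, Pi.add_apply, Pi.pow_apply]
    generalize jacobiSn e t = s at *
    generalize jacobiCn e t = c at *
    generalize jacobiDn e t = d at *
    generalize jacobiSn e (w - t) = s' at *
    generalize jacobiCn e (w - t) = c' at *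
    generalize jacobiDn e (w - t) = d' at *
    -- The numerator of g' vanishes modulo cn² = 1 - sn² and dn² = 1 - e² sn² at t and at w - t.
    linear_combination s * s' * (1 - e ^ 2 * s ^ 2 * s' ^ 2) * (hds' - hds + e ^ 2 * (hcs' - hcs)) +
      2 * e ^ 2 * s * s' * (s' ^ 2 * (c ^ 2 * hds + (1 - e ^ 2 * s ^ 2) * hcs) -
        s ^ 2 * (c' ^ 2 * hds' + (1 - e ^ 2 * s' ^ 2) * hcs'))
  have h0 := is_const_of_deriv_eq_zero (fun t => (hg t).differentiableAt)
    (fun t => (hg t).deriv) 0 u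
  have hwu : w - u = v := by rw [hw]; ring
  have hz := jacobiAm_zero he0 he1
  simp only [g, hwu, sub_zero] at h0
  rw [← h0]
  simp [jacobiDn, jacobiSn, jacobiCn, hz]

/-- The addition theorem for the elliptic cosine. -/
theorem jacobiCn_add {e : ℝ} (he0 : 0 < e) (he1 : e < 1) (u v : ℝ) :
    jacobiCn e (u + v) =
      (jacobiCn e u * jacobiCn e v - jacobiSn e u * jacobiSn e v * jacobiDn e u * jacobiDn e v) /
        (1 - e ^ 2 * jacobiSn e u ^ 2 * jacobiSn e v ^ 2) := by
  set w := u + v with hw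
  -- As for sn: the right-hand side is constant when the sum of the arguments is fixed.
  let g : ℝ → ℝ := fun t =>
    (jacobiCn e t * jacobiCn e (w - t)
        - jacobiSn e t * jacobiSn e (w - t) * jacobiDn e t * jacobiDn e (w - t)) /
      (1 - e ^ 2 * jacobiSn e t ^ 2 * jacobiSn e (w - t) ^ 2)
  have hg : ∀ t, HasDerivAt g 0 t := fun t => by
    have hs := hasDerivAt_jacobiSn he0 he1 t
    have hc := hasDerivAt_jacobiCn he0 he1 t
    have hd := hasDerivAt_jacobiDn he0 he1 t
    have hs' := (hasDerivAt_jacobiSn he0 he1 (w - t)).comp_const_sub w t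
    have hc' := (hasDerivAt_jacobiCn he0 he1 (w - t)).comp_const_sub w t
    have hd' := (hasDerivAt_jacobiDn he0 he1 (w - t)).comp_const_sub w t
    have hD := (jacobi_addition_denom_pos he0 he1 t (w - t)).ne'
    have h := ((hc.mul hc').sub (((hs.mul hs').mul hd).mul hd')).div
      ((((hs.pow 2).const_mul (e ^ 2)).mul (hs'.pow 2)).const_sub 1) hD
    refine h.congr_deriv (div_eq_zero_iff.2 (Or.inl ?_))
    have hcs := jacobiCn_sq e t
    have hcs' := jacobiCn_sq e (w - t)
    have hds := jacobiDn_sq he0 he1 t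
    have hds' := jacobiDn_sq he0 he1 (w - t)
    simp only [Pi.mul_apply, Pi.sub_apply, Pi.pow_apply]
    generalize jacobiSn e t = s at *
    generalize jacobiCn e t = c at *
    generalize jacobiDn e t = d at *
    generalize jacobiSn e (w - t) = s' at *
    generalize jacobiCn e (w - t) = c' at *
    generalize jacobiDn e (w - t) = d' at *
    linear_combination (1 - e ^ 2 * s ^ 2 * s' ^ 2) * (s * c' * d * hds' - c * s' * d' * hds) +
      2 * e ^ 2 * s * s' * (s' * c' * d * (hcs + s ^ 2 * hds') -
        s * c * d' * (s' ^ 2 * hds + hcs'))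
  have h0 := is_const_of_deriv_eq_zero (fun t => (hg t).differentiableAt)
    (fun t => (hg t).deriv) 0 u
  have hwu : w - u = v := by rw [hw]; ring
  have hz := jacobiAm_zero he0 he1
  simp only [g, hwu, sub_zero] at h0
  rw [← h0]
  simp [jacobiDn, jacobiSn, jacobiCn, hz]

end Jacobi

/-! ### Positively oriented tangent segments of confocal ellipses -/

section Tangent

/-- Both coefficients of the equation increase strictly with the eccentricity, so a common point
would have to be the origin. -/
theorem disjoint_confocalEllipse {e f : ℝ} (hf : 0 < f) (hfe : f < e) (he : e < 1) :
    Disjoint (confocalEllipse f) (confocalEllipse e) := by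
  refine Set.disjoint_left.2 fun p h1 h2 => ?_
  simp only [confocalEllipse, Set.mem_ofPred_eq] at h1 h2
  have h3 : f ^ 2 < e ^ 2 := by nlinarith
  have h4 : 0 < 1 - e ^ 2 := by nlinarith
  have h5 : f ^ 2 / (1 - f ^ 2) < e ^ 2 / (1 - e ^ 2) := by
    rw [div_lt_div_iff₀ (by linarith) h4]
    nlinarith
  have h6 : p.1 ^ 2 = 0 := by nlinarith [sq_nonneg p.1, sq_nonneg p.2]
  have h7 : p.2 ^ 2 = 0 := by nlinarith [sq_nonneg p.1, sq_nonneg p.2]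
  rw [h6, h7] at h1
  norm_num at h1

/-- A line meets an ellipse in at most two points. -/
theorem eq_of_planeCross_eq_zero {f : ℝ} (hf0 : 0 < f) (hf1 : f < 1) {z w w' : ℝ × ℝ}
    (hz : z ∈ confocalEllipse f) (hw : w ∈ confocalEllipse f) (hw' : w' ∈ confocalEllipse f)
    (hzw : z ≠ w) (hzw' : z ≠ w') (h : planeCross (w - z) (w' - z) = 0) : w = w' := by
  obtain ⟨z1, z2⟩ := z
  obtain ⟨w1, w2⟩ := w
  obtain ⟨v1, v2⟩ := w'
  simp only [confocalEllipse, Set.mem_ofPred_eq] at hz hw hw'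
  simp only [planeCross, Prod.fst_sub, Prod.snd_sub] at h
  have hA : 0 < f ^ 2 := by positivity
  have hB : 0 < f ^ 2 / (1 - f ^ 2) := div_pos hA (by nlinarith)
  generalize f ^ 2 = A at *
  generalize A / (1 - A) = B at *
  obtain ⟨r, h1, h2⟩ : ∃ r, v1 - z1 = r * (w1 - z1) ∧ v2 - z2 = r * (w2 - z2) := by
    by_cases h1 : w1 - z1 = 0
    · have h2 : w2 - z2 ≠ 0 := fun h2 => hzw (by
        rw [sub_eq_zero.1 h1, sub_eq_zero.1 h2])
      refine ⟨(v2 - z2) / (w2 - z2), ?_, by field_simp⟩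
      have : v1 - z1 = 0 := by
        have h3 : (w2 - z2) * (v1 - z1) = 0 := by rw [h1] at h; linarith
        exact (mul_eq_zero.1 h3).resolve_left h2
      rw [this, h1, mul_zero]
    · refine ⟨(v1 - z1) / (w1 - z1), by field_simp, ?_⟩
      field_simp
      linarith
  have hv1 : v1 = z1 + r * (w1 - z1) := by linarith
  have hv2 : v2 = z2 + r * (w2 - z2) := by linarith
  have hr : r ≠ 0 := fun hr => hzw' (by rw [hv1, hv2, hr]; simp)
  have hq : A * (w1 - z1) ^ 2 + B * (w2 - z2) ^ 2 ≠ 0 := fun hq => by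
    have h3 : A * (w1 - z1) ^ 2 = 0 := by
      nlinarith [mul_nonneg hA.le (sq_nonneg (w1 - z1)), mul_nonneg hB.le (sq_nonneg (w2 - z2))]
    have h4 : B * (w2 - z2) ^ 2 = 0 := by linarith
    have h5 := pow_eq_zero_iff two_ne_zero |>.1 ((mul_eq_zero.1 h3).resolve_left hA.ne')
    have h6 := pow_eq_zero_iff two_ne_zero |>.1 ((mul_eq_zero.1 h4).resolve_left hB.ne')
    exact hzw (by rw [sub_eq_zero.1 h5, sub_eq_zero.1 h6])
  -- Along the line z + r(w - z), the equation of the ellipse is quadratic in r with roots 0 and 1.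
  have key : r * (A * (w1 - z1) ^ 2 + B * (w2 - z2) ^ 2) * (r - 1) = 0 := by
    rw [hv1, hv2] at hw'
    linear_combination hw' - r * hw - (1 - r) * hz
  have hr1 : r = 1 := by
    have := (mul_eq_zero.1 key).resolve_left (mul_ne_zero hr hq)
    linarith
  rw [hv1, hv2, hr1]
  simp

/-- The positively tangent chords of the outer ellipse are determined by their initial points. -/
theorem IsPositivelyTangent.endpoint_unique {e f : ℝ} (hf : 0 < f) (hfe : f < e) (he : e < 1)
    {z w w' : ℝ × ℝ} (hz : z ∈ confocalEllipse f) (hw : w ∈ confocalEllipse f)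
    (hw' : w' ∈ confocalEllipse f) (h : IsPositivelyTangent (confocalEllipse e) z w)
    (h' : IsPositivelyTangent (confocalEllipse e) z w') : w = w' := by
  -- The tangency point of the chord to w' lies left of the chord to w, which fixes the sign of the
  -- cross product. By antisymmetry, exchanging the chords forces it to vanish.
  have aux : ∀ {w w' : ℝ × ℝ}, IsPositivelyTangent (confocalEllipse e) z w →
      IsPositivelyTangent (confocalEllipse e) z w' → 0 ≤ planeCross (w - z) (w' - z) := by
    rintro w w' ⟨-, -, h⟩ ⟨-, ⟨p, hp, hps⟩, -⟩
    rw [segment_eq_image'] at hps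
    obtain ⟨μ, ⟨hμ, -⟩, rfl⟩ := hps
    have hμ' : 0 < μ := hμ.lt_of_ne fun h0 => by
      simp only [← h0, zero_smul, add_zero] at hp
      exact Set.disjoint_left.1 (disjoint_confocalEllipse hf hfe he) hz hp
    have h1 := h _ hp
    rw [show planeCross (w - z) (z + μ • (w' - z) - z) = μ * planeCross (w - z) (w' - z) by
      simp [planeCross]; ring] at h1
    exact (mul_nonneg_iff_of_pos_left hμ').1 h1
  refine eq_of_planeCross_eq_zero hf (hfe.trans he) hz hw hw' h.1 h'.1 (le_antisymm ?_ (aux h h'))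
  have h1 := aux h' h
  simp only [planeCross] at h1 ⊢
  linarith

/-- The parametrization of an ellipse by Jacobi's elliptic functions of modulus `e`. -/
noncomputable def jacobiParam (e ε : ℝ) (h0 : 0 < ε) (h1 : ε < 1) (u : ℝ) : confocalEllipse ε :=
  ellipseParam ε h0 h1 ((jacobiAm e u + Real.pi / 2) / (2 * Real.pi))

/-- The offset π/2 measures the amplitude from the end of the minor axis, whence (-sn, cn) in place
of (cos, sin). -/
theorem jacobiParam_coe (e ε : ℝ) (h0 : 0 < ε) (h1 : ε < 1) (u : ℝ) :
    (jacobiParam e ε h0 h1 u : ℝ × ℝ) =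
      (1 / ε * -jacobiSn e u, 1 / ε * (Real.sqrt (1 - ε ^ 2) * jacobiCn e u)) := by
  simp only [jacobiParam, ellipseParam, mul_div_cancel₀ _ Real.two_pi_pos.ne',
    Real.cos_add_pi_div_two, Real.sin_add_pi_div_two, jacobiSn, jacobiCn]

theorem sin_billiardAngle {e f : ℝ} (hf : 0 < f) (hfe : f < e) (he : e < 1) :
    Real.sin (billiardAngle e f) = Real.sqrt ((e ^ 2 - f ^ 2) / (e ^ 2 * (1 - f ^ 2))) := by
  refine Real.sin_arcsin ((by norm_num : (-1 : ℝ) ≤ 0).trans (Real.sqrt_nonneg _))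
    (Real.sqrt_le_one.2 ?_)
  have : 0 < 1 - f ^ 2 := by nlinarith
  have : 0 < e := hf.trans hfe
  rw [div_le_one (by positivity)]
  have h1 : e ^ 2 < 1 := by nlinarith
  nlinarith [sq_nonneg f]

theorem billiardAngle_mem {e f : ℝ} (hf : 0 < f) (hfe : f < e) (he : e < 1) :
    billiardAngle e f ∈ Set.Ioc 0 (Real.pi / 2) := by
  refine ⟨Real.arcsin_pos.2 (Real.sqrt_pos.2 ?_), Real.arcsin_le_pi_div_two _⟩
  have h1 : 0 < 1 - f ^ 2 := by nlinarith
  have h2 : 0 < e := hf.trans hfe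
  have h3 : 0 < e ^ 2 - f ^ 2 := by nlinarith
  positivity

/-- The parameter length, on the outer ellipse, between a point of tangency and the end of the
tangent chord. -/
noncomputable def billiardShift (e f : ℝ) : ℝ := ellipticF (billiardAngle e f) e

theorem jacobiSn_billiardShift_pos {e f : ℝ} (hf : 0 < f) (hfe : f < e) (he : e < 1) :
    0 < jacobiSn e (billiardShift e f) := by
  rw [jacobiSn, billiardShift, jacobiAm_ellipticF (hf.trans hfe) he]
  have h := billiardAngle_mem hf hfe he
  exact Real.sin_pos_of_pos_of_lt_pi h.1 (by linarith [h.2, Real.pi_pos])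

theorem jacobiSn_billiardShift_sq {e f : ℝ} (hf : 0 < f) (hfe : f < e) (he : e < 1) :
    jacobiSn e (billiardShift e f) ^ 2 = (e ^ 2 - f ^ 2) / (e ^ 2 * (1 - f ^ 2)) := by
  rw [jacobiSn, billiardShift, jacobiAm_ellipticF (hf.trans hfe) he, sin_billiardAngle hf hfe he]
  refine Real.sq_sqrt (div_nonneg ?_ (mul_nonneg (sq_nonneg e) ?_)) <;> nlinarith

/-- This relation makes the chord from s - c to s + c parallel to the tangent of the inner ellipse
at s. -/
theorem jacobiDn_billiardShift {e f : ℝ} (hf : 0 < f) (hfe : f < e) (he : e < 1) :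
    Real.sqrt (1 - f ^ 2) * jacobiDn e (billiardShift e f) = Real.sqrt (1 - e ^ 2) := by
  have h1 : 0 < 1 - f ^ 2 := by nlinarith
  have h2 : e ≠ 0 := (hf.trans hfe).ne'
  rw [jacobiDn, ← Real.sqrt_mul h1.le, jacobiSn_billiardShift_sq hf hfe he]
  congr 1
  field_simp
  ring

/-- Used to show that the point of parameter s on the inner ellipse lies on the chord. The squares
agree, and cn c ≥ 0 because ω̂ ≤ π/2. -/
theorem jacobiCn_billiardShift {e f : ℝ} (hf : 0 < f) (hfe : f < e) (he : e < 1) :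
    e * jacobiCn e (billiardShift e f) = f * jacobiDn e (billiardShift e f) := by
  have he0 := hf.trans hfe
  have h1 : 0 < 1 - f ^ 2 := by nlinarith
  have h0 : 0 ≤ jacobiCn e (billiardShift e f) := by
    rw [jacobiCn, billiardShift, jacobiAm_ellipticF he0 he]
    have h := billiardAngle_mem hf hfe he
    exact Real.cos_nonneg_of_neg_pi_div_two_le_of_le (by linarith [h.1, Real.pi_pos]) h.2
  refine (pow_left_inj₀ (mul_nonneg he0.le h0)
    (mul_nonneg hf.le (jacobiDn_pos he0 he _).le) two_ne_zero).1 ?_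
  rw [mul_pow, mul_pow, jacobiCn_sq, jacobiDn_sq he0 he, jacobiSn_billiardShift_sq hf hfe he]
  field_simp
  ring

/-- The chord of the outer ellipse between the parameters `s - c` and `s + c`, where `c` is the
billiard shift, is tangent to the inner ellipse at its point of parameter `s`. -/
theorem isPositivelyTangent_jacobiParam {e f : ℝ} (hf : 0 < f) (hfe : f < e) (he : e < 1)
    (s : ℝ) :
    IsPositivelyTangent (confocalEllipse e)
      (jacobiParam e f hf (hfe.trans he) (s - billiardShift e f))
      (jacobiParam e f hf (hfe.trans he) (s + billiardShift e f)) := by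
  have he0 := hf.trans hfe
  have hN := jacobi_addition_denom_pos he0 he s (billiardShift e f)
  have hD := jacobiDn_pos he0 he s
  have hδ := jacobiDn_pos he0 he (billiardShift e f)
  have hσ := jacobiSn_billiardShift_pos hf hfe he
  have hcs := jacobiCn_sq e s
  have hds := jacobiDn_sq he0 he s
  have hcs' := jacobiCn_sq e (billiardShift e f)
  have hds' := jacobiDn_sq he0 he (billiardShift e f)
  have hdc := jacobiDn_billiardShift hf hfe he
  have hcc := jacobiCn_billiardShift hf hfe he
  have hPsq : Real.sqrt (1 - e ^ 2) ^ 2 = 1 - e ^ 2 := Real.sq_sqrt (by nlinarith)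
  have hP : 0 < Real.sqrt (1 - e ^ 2) := Real.sqrt_pos.2 (by nlinarith)
  have hp := (jacobiParam e e he0 he s).2
  rw [jacobiParam_coe] at hp ⊢
  rw [jacobiParam_coe, sub_eq_add_neg s, jacobiSn_add he0 he, jacobiSn_add he0 he,
    jacobiCn_add he0 he, jacobiCn_add he0 he, jacobiSn_neg he0 he, jacobiCn_neg he0 he,
    jacobiDn_neg he0 he, neg_sq]
  set S := jacobiSn e s
  set C := jacobiCn e s
  set D := jacobiDn e s
  set σ := jacobiSn e (billiardShift e f)
  set κ := jacobiCn e (billiardShift e f)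
  set δ := jacobiDn e (billiardShift e f)
  set N := 1 - e ^ 2 * S ^ 2 * σ ^ 2 with hNdef
  set P := Real.sqrt (1 - e ^ 2)
  set Q := Real.sqrt (1 - f ^ 2)
  clear_value S C D σ κ δ N P Q
  have hκ : κ = f * δ / e := by field_simp; linarith
  have hQ : Q = P / δ := by field_simp; linarith
  set z : ℝ × ℝ := (1 / f * -((S * κ * δ + -σ * C * D) / N),
    1 / f * (Q * ((C * κ - S * -σ * D * δ) / N))) with hz
  set w : ℝ × ℝ := (1 / f * -((S * κ * δ + σ * C * D) / N),
    1 / f * (Q * ((C * κ - S * σ * D * δ) / N))) with hw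
  -- (-C, -PS) is the velocity of the inner parametrization at s, divided by D.
  have hwz : w - z = (2 * σ * D / (f * N)) • ((-C, -(P * S)) : ℝ × ℝ) := by
    rw [hw, hz, ← hdc]
    ext <;> simp <;> field_simp <;> ring
  have hL : 0 < 2 * σ * D / (f * N) := by positivity
  have hpz : ((1 / e * -S, 1 / e * (P * C)) : ℝ × ℝ) - z =
      (1 / 2 + e ^ 2 * S * C * σ * κ / (2 * D * δ)) • (w - z) := by
    rw [hwz, hz, hκ, hQ]
    ext
    · simp
      field_simp
      linear_combination S * f * (hds' - hNdef + e ^ 2 * σ ^ 2 * hcs)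
    · simp
      field_simp
      linear_combination C * f * hNdef
  -- This puts the tangency point between z and w. It follows from |C| ≤ D, |κ| ≤ δ, |eS| ≤ 1 and
  -- |eσ| ≤ 1.
  have hμ : |e ^ 2 * S * C * σ * κ / (2 * D * δ)| ≤ 1 / 2 := by
    have h1 : C ^ 2 ≤ D ^ 2 := by
      rw [hcs, hds]
      nlinarith [sq_nonneg S]
    have h2 : κ ^ 2 ≤ δ ^ 2 := by
      rw [hcs', hds']
      nlinarith [sq_nonneg σ]
    have h3 : (e * S) ^ 2 ≤ 1 := by nlinarith [sq_nonneg D]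
    have h4 : (e * σ) ^ 2 ≤ 1 := by nlinarith [sq_nonneg δ]
    rw [abs_div, abs_of_pos (show 0 < 2 * D * δ by positivity), div_le_iff₀ (by positivity)]
    calc |e ^ 2 * S * C * σ * κ| = |e * S| * |C| * (|e * σ| * |κ|) := by
          rw [← abs_mul, ← abs_mul, ← abs_mul]
          ring_nf
      _ ≤ 1 * D * (1 * δ) := by
          gcongr
          · exact abs_le_one_iff_mul_self_le_one.2 (by linarith)
          · exact abs_le_of_sq_le_sq h1 hD.le
          · exact abs_le_one_iff_mul_self_le_one.2 (by linarith)
          · exact abs_le_of_sq_le_sq h2 hδ.le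
      _ = 1 / 2 * (2 * D * δ) := by ring
  rw [abs_le] at hμ
  -- The base point z may be replaced by the tangency point, since both lie on the chord.
  have hcross : ∀ q : ℝ × ℝ, planeCross (w - z) (q - z) =
      2 * σ * D / (f * N) * (P / e - C * q.2 + P * S * q.1) := fun q => by
    have h1 : planeCross (w - z) (q - z) =
        planeCross (w - z) (q - (1 / e * -S, 1 / e * (P * C))) := by
      have h2 := congrArg Prod.fst hpz
      have h3 := congrArg Prod.snd hpz
      simp only [planeCross, Prod.fst_sub, Prod.snd_sub, Prod.smul_fst, Prod.smul_snd,
        smul_eq_mul] at h2 h3 ⊢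
      linear_combination (w.1 - z.1) * h3 - (w.2 - z.2) * h2
    rw [h1, hwz]
    simp only [planeCross, Prod.fst_sub, Prod.snd_sub, Prod.smul_fst, Prod.smul_snd,
        smul_eq_mul]
    field_simp
    linear_combination P * hcs
  refine ⟨fun h => ?_, ⟨_, hp, ?_⟩, fun q hq => ?_⟩
  · rw [h, sub_self] at hwz
    have h1 := congrArg Prod.fst hwz
    have h2 := congrArg Prod.snd hwz
    simp only [Prod.fst_zero, Prod.snd_zero, Prod.smul_fst, Prod.smul_snd, smul_eq_mul] at h1 h2
    have h3 := (mul_eq_zero.1 h1.symm).resolve_left hL.ne'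
    have h4 := (mul_eq_zero.1 (neg_eq_zero.1 ((mul_eq_zero.1 h2.symm).resolve_left
      hL.ne'))).resolve_left hP.ne'
    rw [h4, neg_eq_zero.1 h3] at hcs
    norm_num at hcs
  · rw [segment_eq_image']
    exact ⟨1 / 2 + e ^ 2 * S * C * σ * κ / (2 * D * δ), ⟨by linarith, by linarith⟩, by
      simp only [← hpz, add_sub_cancel]⟩
  · rw [hcross]
    refine mul_nonneg hL.le ?_
    simp only [confocalEllipse, Set.mem_ofPred_eq, ← hPsq] at hq
    -- Cauchy–Schwarz for the unit vector (C, -S) and (q₂, Pq₁), whose norm is P/e on the inner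
    -- ellipse.
    have h1 : (C * q.2 - P * S * q.1) ^ 2 ≤ (P / e) ^ 2 := by
      have h2 : (P / e) ^ 2 = q.2 ^ 2 + (P * q.1) ^ 2 := by
        rw [div_pow, div_eq_iff (by positivity), ← mul_one (P ^ 2), ← hq]
        field_simp
        ring
      rw [h2]
      nlinarith [sq_nonneg (S * q.2 + P * C * q.1)]
    linarith [abs_le_of_sq_le_sq' h1 (by positivity)]

end Tangent

/-! ### The Poncelet map and its rotation number -/

section RotationNumber

theorem continuous_ellipseParam {f : ℝ} (hf0 : 0 < f) (hf1 : f < 1) :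
    Continuous (ellipseParam f hf0 hf1) :=
  Continuous.subtype_mk (by fun_prop) _

theorem surjective_ellipseParam {f : ℝ} (hf0 : 0 < f) (hf1 : f < 1) :
    Function.Surjective (ellipseParam f hf0 hf1) := by
  rintro ⟨⟨x, y⟩, h⟩
  have hp := h
  simp only [confocalEllipse, Set.mem_ofPred_eq] at hp
  have h0 : 0 < 1 - f ^ 2 := by nlinarith
  have hQ : 0 < Real.sqrt (1 - f ^ 2) := Real.sqrt_pos.2 h0
  have hQ2 : Real.sqrt (1 - f ^ 2) ^ 2 = 1 - f ^ 2 := Real.sq_sqrt h0.le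
  obtain ⟨θ, h1, h2⟩ : ∃ θ : ℝ, Real.cos θ = f * x ∧
      Real.sin θ = f * y / Real.sqrt (1 - f ^ 2) := by
    have hn : ‖(⟨f * x, f * y / Real.sqrt (1 - f ^ 2)⟩ : ℂ)‖ = 1 := by
      rw [Complex.norm_def, Real.sqrt_eq_one, Complex.normSq_mk]
      rw [← hQ2] at hp
      linear_combination hp
    have hn0 : (⟨f * x, f * y / Real.sqrt (1 - f ^ 2)⟩ : ℂ) ≠ 0 := fun h0 => by
      rw [h0, norm_zero] at hn
      exact zero_ne_one hn
    refine ⟨Complex.arg ⟨f * x, f * y / Real.sqrt (1 - f ^ 2)⟩, ?_, ?_⟩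
    · rw [Complex.cos_arg hn0, hn, div_one]
    · rw [Complex.sin_arg, hn, div_one]
  refine ⟨θ / (2 * Real.pi), Subtype.ext ?_⟩
  simp only [ellipseParam, mul_div_cancel₀ _ Real.two_pi_pos.ne', h1, h2]
  ext <;> field_simp

theorem ellipseParam_eq_iff {f : ℝ} (hf0 : 0 < f) (hf1 : f < 1) (s t : ℝ) :
    ellipseParam f hf0 hf1 s = ellipseParam f hf0 hf1 t ↔ ∃ n : ℤ, s = t + n := by
  have hQ : Real.sqrt (1 - f ^ 2) ≠ 0 := (Real.sqrt_pos.2 (by nlinarith)).ne'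
  have hf : 1 / f ≠ 0 := (one_div_pos.2 hf0).ne'
  simp only [ellipseParam, Subtype.mk.injEq, Prod.mk.injEq, mul_right_inj' hf, mul_right_inj' hQ]
  constructor
  · rintro ⟨h1, h2⟩
    obtain ⟨n, hn⟩ := Real.Angle.angle_eq_iff_two_pi_dvd_sub.1 (Real.Angle.cos_sin_inj h1 h2)
    refine ⟨n, ?_⟩
    have := Real.two_pi_pos.ne'
    field_simp at hn
    linarith
  · rintro ⟨n, rfl⟩
    rw [show 2 * Real.pi * (t + n) = 2 * Real.pi * t + n * (2 * Real.pi) by ring]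
    exact ⟨Real.cos_add_int_mul_two_pi _ _, Real.sin_add_int_mul_two_pi _ _⟩

/-- Two lifts of the same self-map of the ellipse have translation numbers congruent modulo `1`. -/
theorem IsCircleLift.translationNumber_congr {f : ℝ} (hf0 : 0 < f) (hf1 : f < 1)
    {P : confocalEllipse f → confocalEllipse f} {G H : CircleDeg1Lift}
    (hG : IsCircleLift (ellipseParam f hf0 hf1) P G)
    (hH : IsCircleLift (ellipseParam f hf0 hf1) P H) :
    ∃ m : ℤ, G.translationNumber = H.translationNumber + m := by
  have h : ∀ t, ∃ n : ℤ, G t = H t + n := fun t =>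
    (ellipseParam_eq_iff hf0 hf1 _ _).1 ((hG.2 t).trans (hH.2 t).symm)
  choose n hn using h
  -- The difference of two lifts is continuous and integer-valued, hence constant.
  have hc : Continuous n := by
    rw [Int.isClosedEmbedding_coe_real.isEmbedding.continuous_iff]
    exact (hG.1.sub hH.1).congr fun t => by simp [hn t]
  have hconst : ∀ t, n t = n 0 := fun t => PreconnectedSpace.constant inferInstance hc
  refine ⟨n 0, ?_⟩
  have hGH : G = CircleDeg1Lift.translate (Multiplicative.ofAdd (n 0 : ℝ)) * H := by
    ext t
    simp [hn t, hconst t, add_comm]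
  have hcomm : Commute (CircleDeg1Lift.translate (Multiplicative.ofAdd (n 0 : ℝ)) :
      CircleDeg1Lift) H := by
    ext t
    simp
  rw [hGH, CircleDeg1Lift.translationNumber_mul_of_commute hcomm,
    CircleDeg1Lift.translationNumber_translate, add_comm]

theorem jacobiParam_ellipticF {e ε : ℝ} (he0 : 0 < e) (he1 : e < 1) (h0 : 0 < ε) (h1 : ε < 1)
    (t : ℝ) :
    jacobiParam e ε h0 h1 (ellipticF (2 * Real.pi * t - Real.pi / 2) e) =
      ellipseParam ε h0 h1 t := by
  rw [jacobiParam, jacobiAm_ellipticF he0 he1, sub_add_cancel,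
    mul_div_cancel_left₀ _ Real.two_pi_pos.ne']

/-- The change of parameter from the trigonometric to the elliptic parametrization of an ellipse,
normalized to be a lift of a circle map of degree one. -/
noncomputable def ellipticLift {e : ℝ} (he0 : 0 < e) (he1 : e < 1) : CircleDeg1Lift where
  toFun t := ellipticF (2 * Real.pi * t - Real.pi / 2) e / (4 * ellipticK e)
  monotone' s t h := by
    have := ellipticK_pos he0 he1
    have := Real.pi_pos
    refine div_le_div_of_nonneg_right ((strictMono_ellipticF he0 he1).monotone ?_) (by positivity)
    gcongr
  map_add_one' t := by
    have := ellipticK_pos he0 he1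
    rw [show 2 * Real.pi * (t + 1) - Real.pi / 2 =
      2 * Real.pi * t - Real.pi / 2 + 2 * Real.pi by ring, ellipticF_add_two_pi he0 he1]
    field_simp

theorem ellipticLift_apply {e : ℝ} (he0 : 0 < e) (he1 : e < 1) (t : ℝ) :
    ellipticLift he0 he1 t = ellipticF (2 * Real.pi * t - Real.pi / 2) e / (4 * ellipticK e) := rfl

theorem ellipticF_eq_ellipticLift {e : ℝ} (he0 : 0 < e) (he1 : e < 1) (u : ℝ) :
    u = 4 * ellipticK e * ellipticLift he0 he1 ((jacobiAm e u + Real.pi / 2) / (2 * Real.pi)) := by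
  have := ellipticK_pos he0 he1
  rw [ellipticLift_apply, mul_div_cancel₀ _ Real.two_pi_pos.ne', add_sub_cancel_right,
    ellipticF_jacobiAm he0 he1]
  field_simp

theorem jacobiAm_add_period {e : ℝ} (he0 : 0 < e) (he1 : e < 1) (u : ℝ) :
    jacobiAm e (u + 4 * ellipticK e) = jacobiAm e u + 2 * Real.pi := by
  conv_lhs => rw [← ellipticF_jacobiAm he0 he1 u, ← ellipticF_add_two_pi he0 he1]
  exact jacobiAm_ellipticF he0 he1 _

theorem jacobiParam_periodic {e ε : ℝ} (he0 : 0 < e) (he1 : e < 1) (h0 : 0 < ε) (h1 : ε < 1) :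
    Function.Periodic (jacobiParam e ε h0 h1) (4 * ellipticK e) := fun u => by
  rw [jacobiParam, jacobiParam, jacobiAm_add_period he0 he1, ellipseParam_eq_iff]
  refine ⟨1, ?_⟩
  have := Real.two_pi_pos.ne'
  field_simp
  push_cast
  ring

theorem continuous_jacobiParam {e ε : ℝ} (he0 : 0 < e) (he1 : e < 1) (h0 : 0 < ε) (h1 : ε < 1) :
    Continuous (jacobiParam e ε h0 h1) :=
  (continuous_ellipseParam h0 h1).comp (by have := continuous_jacobiAm he0 he1; fun_prop)

theorem surjective_jacobiParam {e ε : ℝ} (he0 : 0 < e) (he1 : e < 1) (h0 : 0 < ε) (h1 : ε < 1) :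
    Function.Surjective (jacobiParam e ε h0 h1) := fun z => by
  obtain ⟨t, rfl⟩ := surjective_ellipseParam h0 h1 z
  exact ⟨_, jacobiParam_ellipticF he0 he1 h0 h1 t⟩

/-- An ellipse is homeomorphic to a circle by means of its elliptic parametrization. -/
theorem exists_homeomorph_addCircle {e ε : ℝ} (he0 : 0 < e) (he1 : e < 1) (h0 : 0 < ε)
    (h1 : ε < 1) :
    ∃ Φ : AddCircle (4 * ellipticK e) ≃ₜ confocalEllipse ε,
      ∀ u : ℝ, Φ u = jacobiParam e ε h0 h1 u := by
  have hK := ellipticK_pos he0 he1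
  have : Fact (0 < 4 * ellipticK e) := ⟨by positivity⟩
  let φ : AddCircle (4 * ellipticK e) → confocalEllipse ε :=
    (jacobiParam_periodic he0 he1 h0 h1).lift
  have hφ : Continuous φ := continuous_coinduced_dom.2 (continuous_jacobiParam he0 he1 h0 h1)
  have hb : Function.Bijective φ := by
    refine ⟨fun x y => ?_, fun z => ?_⟩
    · induction x using QuotientAddGroup.induction_on with | H u => ?_
      induction y using QuotientAddGroup.induction_on with | H v => ?_
      intro h
      change jacobiParam e ε h0 h1 u = jacobiParam e ε h0 h1 v at h
      obtain ⟨n, hn⟩ := (ellipseParam_eq_iff h0 h1 _ _).1 h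
      have h2 : u = v + n * (4 * ellipticK e) := by
        rw [ellipticF_eq_ellipticLift he0 he1 u, hn, CircleDeg1Lift.map_add_int, mul_add,
          ← ellipticF_eq_ellipticLift he0 he1 v]
        ring
      rw [h2]
      rw [← zsmul_eq_mul]
      exact QuotientAddGroup.mk_add_of_mem _ (AddSubgroup.zsmul_mem_zmultiples _ _)
    · obtain ⟨u, rfl⟩ := surjective_jacobiParam he0 he1 h0 h1 z
      exact ⟨u, rfl⟩
  exact ⟨hφ.homeoOfEquivCompactToT2 (f := Equiv.ofBijective φ hb), fun u => rfl⟩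

/-- The translation by `a` of the elliptic parameter, as a lift of a circle map of degree one. -/
noncomputable def ellipticTranslation {e : ℝ} (he0 : 0 < e) (he1 : e < 1) (a : ℝ) :
    CircleDeg1Lift where
  toFun t := (jacobiAm e (ellipticF (2 * Real.pi * t - Real.pi / 2) e + a) + Real.pi / 2) /
    (2 * Real.pi)
  monotone' s t h := by
    have := Real.pi_pos
    refine div_le_div_of_nonneg_right (add_le_add_left ((strictMono_jacobiAm he0 he1).monotone
      (add_le_add_left ((strictMono_ellipticF he0 he1).monotone ?_) _)) _) (by positivity)
    gcongr
  map_add_one' t := by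
    rw [show 2 * Real.pi * (t + 1) - Real.pi / 2 =
      2 * Real.pi * t - Real.pi / 2 + 2 * Real.pi by ring, ellipticF_add_two_pi he0 he1,
      add_right_comm, jacobiAm_add_period he0 he1]
    have := Real.two_pi_pos.ne'
    field_simp
    ring

theorem ellipticTranslation_apply {e : ℝ} (he0 : 0 < e) (he1 : e < 1) (a t : ℝ) :
    ellipticTranslation he0 he1 a t =
      (jacobiAm e (ellipticF (2 * Real.pi * t - Real.pi / 2) e + a) + Real.pi / 2) /
        (2 * Real.pi) := rfl

/-- `ellipticLift` semiconjugates this map to the rigid translation by a/4K, and degree-one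
semiconjugacy preserves translation numbers. -/
theorem translationNumber_ellipticTranslation {e : ℝ} (he0 : 0 < e) (he1 : e < 1) (a : ℝ) :
    (ellipticTranslation he0 he1 a).translationNumber = a / (4 * ellipticK e) := by
  rw [← CircleDeg1Lift.translationNumber_translate (a / (4 * ellipticK e))]
  refine CircleDeg1Lift.translationNumber_eq_of_semiconj (f := ellipticLift he0 he1) fun t => ?_
  rw [CircleDeg1Lift.translate_apply, ellipticLift_apply, ellipticLift_apply,
    ellipticTranslation_apply, mul_div_cancel₀ _ Real.two_pi_pos.ne', add_sub_cancel_right,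
    ellipticF_jacobiAm he0 he1]
  ring

theorem isPonceletMap_of_jacobiParam {e f : ℝ} (hf : 0 < f) (hfe : f < e) (he : e < 1)
    {P : confocalEllipse f → confocalEllipse f}
    (hP : ∀ u, P (jacobiParam e f hf (hfe.trans he) u) =
      jacobiParam e f hf (hfe.trans he) (u + 2 * billiardShift e f)) :
    IsPonceletMap (confocalEllipse f) (confocalEllipse e) P := fun z w => by
  obtain ⟨u, rfl⟩ := surjective_jacobiParam (hf.trans hfe) he hf (hfe.trans he) z
  -- The tangency parameter is the midpoint of u and u + 2c.
  have h := isPositivelyTangent_jacobiParam hf hfe he (u + billiardShift e f)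
  rw [add_sub_cancel_right, add_assoc, ← two_mul, ← hP] at h
  exact ⟨fun h' => Subtype.ext (h'.endpoint_unique hf hfe he (Subtype.prop _) w.2
    (Subtype.prop _) h), fun h' => h' ▸ h⟩

end RotationNumber

theorem mainTheorem2 (e f : ℝ) (hf : 0 < f) (hfe : f < e) (he : e < 1) :
    ∃ B : confocalEllipse f ≃ₜ confocalEllipse f,
      IsPonceletMap (confocalEllipse f) (confocalEllipse e) B ∧
      HasRotationNumber (ellipseParam f hf (hfe.trans he)) B
        (ellipticF (billiardAngle e f) e / (2 * ellipticK e)) := by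
  have he0 := hf.trans hfe
  have hK := ellipticK_pos he0 he
  obtain ⟨Φ, hΦ⟩ := exists_homeomorph_addCircle he0 he hf (hfe.trans he)
  let B : confocalEllipse f ≃ₜ confocalEllipse f :=
    (Φ.symm.trans (Homeomorph.addRight ((2 * billiardShift e f : ℝ) : AddCircle _))).trans Φ
  have hB : ∀ u, B (jacobiParam e f hf (hfe.trans he) u) =
      jacobiParam e f hf (hfe.trans he) (u + 2 * billiardShift e f) := fun u => by
    rw [← hΦ, ← hΦ]
    simp [B]
  have hG : IsCircleLift (ellipseParam f hf (hfe.trans he)) B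
      (ellipticTranslation he0 he (2 * billiardShift e f)) := by
    refine ⟨?_, fun t => ?_⟩
    · have h1 := continuous_jacobiAm he0 he
      have h2 := continuous_ellipticF he0 he
      change Continuous fun t : ℝ => (jacobiAm e (ellipticF (2 * Real.pi * t - Real.pi / 2) e +
        2 * billiardShift e f) + Real.pi / 2) / (2 * Real.pi)
      fun_prop
    · rw [← jacobiParam_ellipticF he0 he hf (hfe.trans he) t, hB, ellipticTranslation_apply, jacobiParam]
  refine ⟨B, isPonceletMap_of_jacobiParam hf hfe he hB, ⟨?_, ?_⟩, ⟨_, hG⟩, fun G' hG' => ?_⟩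
  · refine div_nonneg ?_ (by positivity)
    rw [← ellipticF_zero e]
    exact (strictMono_ellipticF he0 he).monotone (billiardAngle_mem hf hfe he).1.le
  -- Since ω̂ ≤ π/2, the value is in fact at most 1/2.
  · rw [div_lt_one (by positivity)]
    have : ellipticF (billiardAngle e f) e ≤ ellipticK e :=
      (strictMono_ellipticF he0 he).monotone (billiardAngle_mem hf hfe he).2
    linarith
  · obtain ⟨m, hm⟩ := hG'.translationNumber_congr hf (hfe.trans he) hG
    refine ⟨m, ?_⟩
    rw [hm, translationNumber_ellipticTranslation, billiardShift]
    congr 1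
    field_simp
    ring
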